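/- Let $n\ge 3$ and let $W_n$ be the wheel graph, obtained from the cycle $C_n$ on the vertices $1,\dots,n$ (in this clockwise order) by joining a further vertex $0$, the sink, to every vertex of $C_n$. A configuration is a vector $c=(c_1,\dots,c_n)$ of non-negative integers ($c_i$ grains at the vertex $i$); it is stable if every $c_i$ is less than the degree $3$ of $i$, i.e. $c\in\{0,1,2\}^n$. In the Abelian sandpile model (ASM) an unstable vertex topples by sending one grain to each of its neighbours; in the stochastic sandpile model (SSM) with parameter $p\in(0,1)$ it sends one grain to each of its neighbours independently with probability $p$, and keeps the other grains. Grains sent to the sink are lost. In both models one considers the Markov chain on stable configurations that at each step adds a grain at a random vertex $i\in\{1,\dots,n\}$, chosen with probability $\mu_i>0$, and then topples unstable vertices until the configuration is stable (in the SSM, the next vertex to topple may be chosen by any fixed rule that selects an unstable vertex as a function of the current configuration). A stable configuration is recurrent for the model if it is a recurrent state of this chain, i.e. the chain started there almost surely returns to it infinitely often; it is minimal recurrent if it is minimal, for the componentwise order, among the recurrent configurations of the model. For $i,j\in\{1,\dots,n\}$ let $(i,j)$ be the open clockwise interval from $i$ to $j$ on the cycle, with $(i,i):=\{1,\dots,n\}\setminus\{i\}$.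 **Theorem.** Let $c\in\{0,1,2\}^n$ be a stable configuration on $W_n$. 1. $c$ is minimal recurrent for the SSM if and only if it satisfies the strict $02$-cycle condition: for all $i,j$ with $c_i=c_j=0$ and $c_\ell\neq 0$ for all $\ell\in(i,j)$ there is a unique $k\in(i,j)$ with $c_k=2$; and, vice versa, for all $i,j$ with $c_i=c_j=2$ and $c_\ell\neq 2$ for all $\ell\in(i,j)$ there is a unique $k\in(i,j)$ with $c_k=0$. 2. $c$ is minimal recurrent for the ASM if and only if $c$ is minimal recurrent for the SSM and $c_i=2$ for some $i$. -/

import Mathlib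

open scoped ENNReal

noncomputable section

namespace Sandpile

/-! ## Absorption of a randomly evolving state -/

section Absorption

variable {α : Type*}

/-- The law, after `k` steps, of a state that starts at `a` and moves according to `T`. -/
def iterLaw (T : α → PMF α) : ℕ → α → PMF α
  | 0, a => PMF.pure a
  | k + 1, a => (T a).bind (iterLaw T k)

/-- The states in `S` are absorbing, `rank` never increases and has finite sublevel sets, and from
every state outside `S` the rank drops with positive probability. -/
structure Dissipative (T : α → PMF α) (S : α → Prop) (rank : α → ℕ) : Prop where
  absorbing : ∀ a, S a → T a = PMF.pure a
  finite : ∀ N, {a | rank a ≤ N}.Finite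
  rank_le : ∀ a b, T a b ≠ 0 → rank b ≤ rank a
  rank_drop : ∀ a, ¬ S a → ∃ b, rank b < rank a ∧ T a b ≠ 0

theorem iterLaw_mono {T : α → PMF α} {S : α → Prop} (hT : ∀ a, S a → T a = PMF.pure a)
    (s : α) (hs : S s) (k : ℕ) : ∀ a, iterLaw T k a s ≤ iterLaw T (k + 1) a s := by
  classical
  induction k with
  | zero =>
    intro a
    simp only [iterLaw, PMF.bind_pure]
    by_cases h : s = a
    · subst h; rw [hT s hs]
    · simp [PMF.pure_apply, h]
  | succ k ih =>
    intro a
    rw [iterLaw, iterLaw, PMF.bind_apply, PMF.bind_apply]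
    exact ENNReal.tsum_le_tsum fun b => mul_le_mul_right (ih b) _

/-- A dissipative evolution is almost surely absorbed in `S`. -/
theorem Dissipative.tsum_eq_one {T : α → PMF α} {S : α → Prop} {rank : α → ℕ}
    (hT : Dissipative T S rank) (a : α) :
    ∑' s : {x // S x}, ⨆ k, iterLaw T k a s = 1 := by
  classical
  have swap : ∀ {β : Type _} (f : ℕ → β → ℝ≥0∞), (∀ b, Monotone fun k => f k b) →
      ∑' b, ⨆ k, f k b = ⨆ k, ∑' b, f k b := by
    intro β f hf
    let _ : MeasurableSpace β := ⊤
    simp only [← MeasureTheory.lintegral_count]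
    exact MeasureTheory.lintegral_iSup (fun _ => measurable_from_top)
      (fun i j hij b => hf b hij)
  have mono : ∀ a (s : {x // S x}), Monotone fun k => iterLaw T k a s := fun a s =>
    monotone_nat_of_le_succ fun k => iterLaw_mono hT.absorbing s s.2 k a
  set g : ℕ → α → ℝ≥0∞ := fun k a => ∑' s : {x // S x}, iterLaw T k a s with hg
  set G : α → ℝ≥0∞ := fun a => ∑' s : {x // S x}, ⨆ k, iterLaw T k a s with hG
  have hGg : ∀ a, G a = ⨆ k, g k a := fun a => swap _ (mono a)
  have gmono : ∀ a, Monotone fun k => g k a := fun a i j hij =>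
    ENNReal.tsum_le_tsum fun s => mono a s hij
  have g_le : ∀ k a, g k a ≤ 1 := fun k a => by
    rw [← (iterLaw T k a).tsum_coe]
    exact ENNReal.tsum_comp_le_tsum_of_injective Subtype.val_injective _
  have G_le : ∀ a, G a ≤ 1 := fun a => by rw [hGg]; exact iSup_le fun k => g_le k a
  have gsucc : ∀ k a, g (k + 1) a = ∑' b, T a b * g k b := by
    intro k a
    simp only [hg, iterLaw, PMF.bind_apply]
    rw [ENNReal.tsum_comm]
    simp only [ENNReal.tsum_mul_left]
  have Grec : ∀ a, ∑' b, T a b * G b ≤ G a := by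
    intro a
    simp only [hGg, ENNReal.mul_iSup]
    rw [swap (fun k b => T a b * g k b) (fun b i j hij => mul_le_mul_right (gmono b hij) _)]
    exact iSup_le fun k => by rw [← gsucc]; exact le_iSup (fun k => g k a) (k + 1)
  have GS : ∀ a, S a → G a = 1 := by
    intro a ha
    refine le_antisymm (G_le a) ?_
    rw [hGg]
    refine le_trans ?_ (le_iSup _ 0)
    refine le_trans ?_ (ENNReal.le_tsum (⟨a, ha⟩ : {x // S x}))
    simp [iterLaw]
  clear_value G
  have key : ∀ N a, rank a ≤ N → G a = 1 := by
    intro N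
    induction N using Nat.strong_induction_on with
    | _ N ih =>
      have hmin : ∀ a, rank a ≤ N → 1 ≤ G a := by
        intro a0 ha0
        obtain ⟨m, hm, hmin⟩ := Set.exists_min_image {a | rank a ≤ N} G (hT.finite N) ⟨a0, ha0⟩
        refine le_trans ?_ (hmin a0 ha0)
        by_cases hS : S m
        · exact (GS m hS).ge
        obtain ⟨b, hb, hTb⟩ := hT.rank_drop m hS
        have hb1 : G b = 1 := ih (rank b) (lt_of_lt_of_le hb hm) b le_rfl
        have hfin : G m ≠ ∞ := ne_top_of_le_ne_top ENNReal.one_ne_top (G_le m)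
        have hTfin : T m b ≠ ∞ := PMF.apply_ne_top _ _
        have hsum : T m b + ∑' x, ite (x = b) 0 (T m x) = 1 := by
          exact (ENNReal.tsum_eq_add_tsum_ite b).symm.trans (T m).tsum_coe
        have hite : ∀ x, ite (x = b) 0 (T m x) * G m ≤ ite (x = b) 0 (T m x * G x) := by
          intro x
          by_cases hx : x = b
          · simp [hx]
          · rw [if_neg hx, if_neg hx]
            by_cases hx0 : T m x = 0
            · simp [hx0]
            · exact mul_le_mul_right (hmin x (le_trans (hT.rank_le m x hx0) hm)) _
        have h1 : T m b * 1 + (∑' x, ite (x = b) 0 (T m x)) * G m ≤ G m := by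
          refine le_trans ?_ (Grec m)
          rw [ENNReal.tsum_eq_add_tsum_ite (f := fun x => T m x * G x) b, hb1,
            ← ENNReal.tsum_mul_right]
          exact add_le_add_right (ENNReal.tsum_le_tsum hite) _
        generalize (∑' x, ite (x = b) 0 (T m x)) = R at hsum h1
        have hRfin : R ≠ ∞ := by
          refine ne_top_of_le_ne_top ENNReal.one_ne_top ?_
          rw [← hsum]; exact le_add_self
        have h2 : T m b * 1 + R * G m ≤ T m b * G m + R * G m := by
          refine h1.trans_eq ?_
          rw [← add_mul, hsum, one_mul]
        have h3 := (ENNReal.add_le_add_iff_right (ENNReal.mul_ne_top hRfin hfin)).1 h2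
        exact (ENNReal.mul_le_mul_iff_right hTb hTfin).1 h3
      exact fun a ha => le_antisymm (G_le a) (hmin a ha)
  have := key (rank a) a le_rfl
  rwa [hG] at this

/-- The law of the state of `S` in which the evolution started at `a` is finally absorbed. -/
def absorbedLaw {T : α → PMF α} {S : α → Prop} {rank : α → ℕ}
    (hT : Dissipative T S rank) (a : α) : PMF {x // S x} :=
  ⟨fun s => ⨆ k, iterLaw T k a s, hT.tsum_eq_one a ▸ ENNReal.summable.hasSum⟩

end Absorption

/-! ## Recurrent states of a Markov chain -/

section MarkovChain

variable {S : Type*} [MeasurableSpace S] [DiscreteMeasurableSpace S] [Countable S]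

/-- The Markov kernel of the transition probabilities `P`. -/
def stepKernel (P : S → PMF S) : ProbabilityTheory.Kernel S S where
  toFun s := (P s).toMeasure
  measurable' := .of_discrete

instance (P : S → PMF S) : ProbabilityTheory.IsMarkovKernel (stepKernel P) :=
  ⟨fun s => PMF.toMeasure.isProbabilityMeasure (P s)⟩

/-- The law on `ℕ → S` of the trajectory of the time-homogeneous Markov chain with transition
probabilities `P` started at `s`. -/
def chainLaw (P : S → PMF S) (s : S) : MeasureTheory.Measure (ℕ → S) :=
  ProbabilityTheory.Kernel.traj (X := fun _ => S)
    (fun n => (stepKernel P).comap (fun h : (i : Finset.Iic n) → S => h ⟨n, by simp⟩)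
      (measurable_pi_apply _)) 0 (fun _ => s)

/-- `s` is recurrent: the chain started at `s` almost surely visits `s` infinitely often. -/
def IsRecurrentState (P : S → PMF S) (s : S) : Prop :=
  ∀ᵐ ω ∂chainLaw P s, ∃ᶠ k in Filter.atTop, ω k = s

end MarkovChain

/-! ## Configurations and topplings

The vertex set of the graph is `Option V`; the sink is `none`. -/

section Sand

variable {V : Type*} [Fintype V] [DecidableEq V]

/-- Every non-sink vertex holds fewer grains than its degree. -/
def IsStable (G : SimpleGraph (Option V)) [DecidableRel G.Adj] (c : V → ℕ) : Prop :=
  ∀ v, c v < G.degree (some v)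

instance (G : SimpleGraph (Option V)) [DecidableRel G.Adj] (c : V → ℕ) :
    Decidable (IsStable G c) := by
  unfold IsStable; infer_instance

/-- The set `Stable(G)` of stable configurations. -/
abbrev StableConfig (G : SimpleGraph (Option V)) [DecidableRel G.Adj] : Type _ :=
  {c : V → ℕ // IsStable G c}

/-- The configuration after `i` has sent one grain to each vertex in `A`, a set of neighbours
of `i`; a grain sent to the sink is lost. -/
def sendGrains (c : V → ℕ) (i : V) (A : Finset (Option V)) : V → ℕ := fun v =>
  (if v = i then c v - A.card else c v) + (if some v ∈ A then 1 else 0)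

/-- Add one grain at `i`. -/
def addGrain (c : V → ℕ) (i : V) : V → ℕ := c + Pi.single i 1

theorem sum_sendGrains (c : V → ℕ) (i : V) (A : Finset (Option V)) (hA : A.card ≤ c i) :
    ∑ v, sendGrains c i A v + (if none ∈ A then 1 else 0) = ∑ v, c v := by
  have h1 : ∑ v, (if some v ∈ A then 1 else 0) + (if none ∈ A then 1 else 0) = A.card := by
    have := Fintype.sum_option (fun o : Option V => if o ∈ A then 1 else 0)
    rw [add_comm, ← this]; simp
  have h2 : ∑ v, (if v = i then c v - A.card else c v) + A.card = ∑ v, c v := by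
    rw [← Finset.add_sum_erase _ _ (Finset.mem_univ i),
      ← Finset.add_sum_erase _ c (Finset.mem_univ i), if_pos rfl,
      Finset.sum_congr rfl fun v hv => if_neg (Finset.ne_of_mem_erase hv)]
    have : ∑ x ∈ Finset.univ.erase i, c x = (Finset.univ.erase i).sum c := rfl
    omega
  simp only [sendGrains, Finset.sum_add_distrib]
  omega

variable (G : SimpleGraph (Option V)) [DecidableRel G.Adj]

theorem finite_sum_le (N : ℕ) : {c : V → ℕ | ∑ v, c v ≤ N}.Finite := by
  refine (Set.finite_Iic (fun _ : V => N)).subset fun c hc v => ?_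
  exact (Finset.single_le_sum (fun _ _ => Nat.zero_le _) (Finset.mem_univ v)).trans hc

/-! ## The Abelian sandpile model -/

/-- `d` arises from `c` by toppling an unstable vertex, which sends one grain to each of its
neighbours. -/
def Topples (c d : V → ℕ) : Prop :=
  ∃ i, G.degree (some i) ≤ c i ∧ d = sendGrains c i (G.neighborFinset (some i))

variable {G}

theorem exists_stabilisation (hG : ∀ v, G.Adj (some v) none) (c : V → ℕ) :
    ∃ s : StableConfig G, Relation.ReflTransGen (Topples G) c s := by
  generalize hN : ∑ v, c v = N
  induction N using Nat.strong_induction_on generalizing c with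
  | _ N ih =>
    by_cases hc : IsStable G c
    · exact ⟨⟨c, hc⟩, .refl⟩
    · simp only [IsStable, not_forall, not_lt] at hc
      obtain ⟨i, hi⟩ := hc
      have hs := sum_sendGrains c i (G.neighborFinset (some i)) (by simpa using hi)
      rw [if_pos (by simpa using hG i)] at hs
      obtain ⟨s, h⟩ := ih _ (by omega) (sendGrains c i (G.neighborFinset (some i))) rfl
      exact ⟨s, .head ⟨i, hi, rfl⟩ h⟩

/-- The stabilisation of `c`: the stable configuration reached by toppling unstable vertices
(it does not depend on the sequence of topplings). -/
def asmStabilise (hG : ∀ v, G.Adj (some v) none) (c : V → ℕ) : StableConfig G :=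
  (exists_stabilisation hG c).choose

/-- One step of the ASM chain: add a grain at a `μ`-random vertex and stabilise. -/
def asmStep (hG : ∀ v, G.Adj (some v) none) (μ : PMF V) (c : StableConfig G) :
    PMF (StableConfig G) :=
  μ.map fun i => asmStabilise hG (addGrain c i)

/-! ## The stochastic sandpile model -/

/-- The random subset of a finite set `N` that contains each element of `N` independently with
probability `p`. -/
def randomSubset {β : Type*} [DecidableEq β] (p : Set.Ioo (0 : ℝ) 1) (N : Finset β) :
    PMF (Finset β) :=
  PMF.ofFinset
    (fun A => if A ⊆ N then
      ENNReal.ofReal p ^ A.card * ENNReal.ofReal (1 - p) ^ (N.card - A.card) else 0)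
    N.powerset
    (by
      rw [Finset.sum_congr rfl fun A hA => if_pos (Finset.mem_powerset.1 hA),
        Finset.sum_pow_mul_eq_add_pow, ← ENNReal.ofReal_add p.2.1.le (by linarith [p.2.2])]
      simp)
    (by
      intro A hA
      rw [if_neg (by simpa using hA)])

variable (G) in
/-- A rule choosing, in every configuration that is not stable, the unstable vertex that topples
next. -/
structure TopplingRule where
  select : (V → ℕ) → V
  unstable_select : ∀ c, ¬ IsStable G c → G.degree (some (select c)) ≤ c (select c)

/-- One random toppling: the unstable vertex `i` chosen by the rule sends a grain to each of its
neighbours independently with probability `p`. A stable configuration does not change. -/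
def ssmTopple (p : Set.Ioo (0 : ℝ) 1) (r : TopplingRule G) (c : V → ℕ) : PMF (V → ℕ) :=
  if IsStable G c then PMF.pure c
  else (randomSubset p (G.neighborFinset (some (r.select c)))).map (sendGrains c (r.select c))

theorem ssmTopple_dissipative (hG : ∀ v, G.Adj (some v) none) (p : Set.Ioo (0 : ℝ) 1)
    (r : TopplingRule G) :
    Dissipative (ssmTopple p r) (IsStable G) (fun c => ∑ v, c v) where
  absorbing c hc := by rw [ssmTopple, if_pos hc]
  finite N := finite_sum_le N
  rank_le c d hd := by
    by_cases hc : IsStable G c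
    · rw [ssmTopple, if_pos hc] at hd
      have : d = c := by
        by_contra h
        exact hd (by simp [PMF.pure_apply, h])
      rw [this]
    · rw [ssmTopple, if_neg hc, ← PMF.mem_support_iff, PMF.mem_support_map_iff] at hd
      obtain ⟨A, hA, rfl⟩ := hd
      have hAN : A ⊆ G.neighborFinset (some (r.select c)) := by
        by_contra h
        exact (PMF.mem_support_iff _ _).1 hA (by simp [randomSubset, h])
      have h1 := Finset.card_le_card hAN
      have h2 := r.unstable_select c hc
      rw [SimpleGraph.card_neighborFinset_eq_degree] at h1
      have := sum_sendGrains c (r.select c) A (h1.trans h2)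
      omega
  rank_drop c hc := by
    refine ⟨sendGrains c (r.select c) (G.neighborFinset (some (r.select c))), ?_, ?_⟩
    · have := sum_sendGrains c (r.select c) (G.neighborFinset (some (r.select c)))
        (by simpa using r.unstable_select c hc)
      rw [if_pos (by simpa using hG _)] at this
      omega
    · rw [ssmTopple, if_neg hc, ← PMF.mem_support_iff, PMF.mem_support_map_iff]
      refine ⟨_, ?_, rfl⟩
      rw [PMF.mem_support_iff]
      simp [randomSubset, p.2.1]

/-- The law of the random stabilisation of `c`, the stable configuration reached from `c` by
successive random topplings. -/
def ssmStabilise (hG : ∀ v, G.Adj (some v) none) (p : Set.Ioo (0 : ℝ) 1) (r : TopplingRule G)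
    (c : V → ℕ) : PMF (StableConfig G) :=
  absorbedLaw (ssmTopple_dissipative hG p r) c

/-- One step of the SSM chain: add a grain at a `μ`-random vertex and stabilise randomly. -/
def ssmStep (hG : ∀ v, G.Adj (some v) none) (p : Set.Ioo (0 : ℝ) 1) (r : TopplingRule G)
    (μ : PMF V) (c : StableConfig G) : PMF (StableConfig G) :=
  μ.bind fun i => ssmStabilise hG p r (addGrain c i)

/-! ## Recurrent configurations -/

/-- `c` is a recurrent configuration for the ASM. -/
def IsASMRecurrent (hG : ∀ v, G.Adj (some v) none) (μ : PMF V) (c : V → ℕ) : Prop :=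
  ∃ hc : IsStable G c, IsRecurrentState (asmStep hG μ) ⟨c, hc⟩

/-- `c` is a recurrent configuration for the SSM. -/
def IsSSMRecurrent (hG : ∀ v, G.Adj (some v) none) (p : Set.Ioo (0 : ℝ) 1) (r : TopplingRule G)
    (μ : PMF V) (c : V → ℕ) : Prop :=
  ∃ hc : IsStable G c, IsRecurrentState (ssmStep hG p r μ) ⟨c, hc⟩

end Sand

/-! ## The wheel graph -/

/-- The wheel graph `W_n`: the join of the cycle graph on `Fin n` and the single vertex `none`. -/
def wheelGraph (n : ℕ) : SimpleGraph (Option (Fin n)) where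
  Adj
    | none, none => False
    | none, some _ => True
    | some _, none => True
    | some i, some j => (SimpleGraph.cycleGraph n).Adj i j
  symm := ⟨by
    rintro (_ | i) (_ | j) h
    · exact h
    · trivial
    · trivial
    · exact SimpleGraph.Adj.symm h⟩
  loopless := ⟨by
    rintro (_ | i) h
    · exact h
    · exact SimpleGraph.irrefl _ h⟩

instance (n : ℕ) : DecidableRel (wheelGraph n).Adj
  | none, none => instDecidableFalse
  | none, some _ => instDecidableTrue
  | some _, none => instDecidableTrue
  | some i, some j => inferInstanceAs (Decidable ((SimpleGraph.cycleGraph n).Adj i j))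

theorem wheelGraph_adj_sink (n : ℕ) (v : Fin n) : (wheelGraph n).Adj (some v) none := trivial

/-- The open clockwise interval from `i` to `j` on the cycle; for `i = j` it is the set of all
vertices other than `i`. -/
def clockwiseIoo {n : ℕ} (i j : Fin n) : Set (Fin n) :=
  if i < j then {l | i < l ∧ l < j} else {l | i < l ∨ l < j}

/-- Between two cyclically consecutive vertices with value `a` (possibly the same vertex, if it is
the only one) there is exactly one vertex with value `b`. -/
def UniqueBetween {n : ℕ} (c : Fin n → ℕ) (a b : ℕ) : Prop :=
  ∀ i j, c i = a → c j = a → (∀ l ∈ clockwiseIoo i j, c l ≠ a) →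
    ∃! k, k ∈ clockwiseIoo i j ∧ c k = b

/-- The strict `02`-cycle condition: between two consecutive zeros there is exactly one two, and
vice versa. -/
def StrictZeroTwoCycle {n : ℕ} (c : Fin n → ℕ) : Prop :=
  UniqueBetween c 0 2 ∧ UniqueBetween c 2 0

end Sandpile

end

/-! From every stable configuration the chain can reach the one with two grains at every cycle
vertex, so the recurrent configurations are those accessible from it. The abelian property makes the
order of topplings and additions irrelevant: a stable `c` is recurrent if and only if the all-twos
configuration plus some extra grains can be toppled legally into `c`, by full topplings in the ASM
and by topplings along arbitrary sets of neighbours in the SSM (`isRecurrentState_iff_legalPath`).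

On the wheel this is governed by orientations of the cycle. If a configuration dominates the
in-degrees of an orientation, it still does after a toppling, once the edges that carried grains are
turned away from the toppled vertex; after a full toppling that vertex is a source, so the
orientation is not a directed cycle (`exists_cycleInDegree_le_sendGrains`). Hence every recurrent
configuration dominates an in-degree vector, in the ASM that of an acyclic orientation. Conversely,
Dhar's burning algorithm makes acyclic in-degree vectors recurrent in both models
(`exists_full_legalPath`). A directed cycle has in-degree one everywhere, and the SSM reaches this
configuration by one further partial toppling (`exists_partial_legalPath`). All in-degree vectors
have the same sum, so distinct ones are incomparable, and they are exactly the minimal recurrent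
configurations.

Finally, zeros and twos among the in-degrees are the sources and sinks of the orientation. They
alternate around the cycle, which is the strict `02`-cycle condition, and the orientation is acyclic
if and only if there is a sink. -/

namespace Sandpile

/-! ### Recurrent states of a finite Markov chain -/

section Recurrence

set_option linter.unusedSectionVars false

open MeasureTheory ProbabilityTheory Filter

variable {S : Type*} [MeasurableSpace S] [DiscreteMeasurableSpace S] [Countable S]

theorem measurableSet_piLE_eval_mem (k : ℕ) (A : Set S) :
    MeasurableSet[Filtration.piLE (X := fun _ => S) k] {ω : ℕ → S | ω k ∈ A} :=
  ⟨(fun h => h ⟨k, by simp⟩) ⁻¹' A, measurable_pi_apply _ (.of_discrete), rfl⟩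

theorem measurableSet_eval_eq (k : ℕ) (r : S) : MeasurableSet {ω : ℕ → S | ω k = r} :=
  (Filtration.piLE (X := fun _ => S)).le k _ (measurableSet_piLE_eval_mem k {r})

instance (P : S → PMF S) (s : S) : IsProbabilityMeasure (chainLaw P s) := by
  unfold chainLaw; infer_instance

/-- Some transition of positive probability leads from `s` to `t`. -/
def Leads (P : S → PMF S) (s t : S) : Prop := P s t ≠ 0

/-- The Markov property, in the form required by the conditional Borel–Cantelli lemma. -/
theorem condExp_chainLaw (P : S → PMF S) (s r : S) (k : ℕ) :
    (chainLaw P s)[{ω : ℕ → S | ω (k + 1) = r}.indicator (1 : (ℕ → S) → ℝ) |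
      Filtration.piLE (X := fun _ => S) k] =ᵐ[chainLaw P s] fun ω => (P (ω k) r).toReal := by
  have hm : MeasurableSet {ω : ℕ → S | ω (k + 1) = r} := measurableSet_eval_eq _ _
  have hint : Integrable ({ω : ℕ → S | ω (k + 1) = r}.indicator (1 : (ℕ → S) → ℝ))
      (chainLaw P s) := (integrable_const (1 : ℝ)).indicator hm
  have h := Kernel.condExp_traj (Nat.zero_le k) hint
  refine h.trans (.of_forall fun ω => ?_)
  simp only
  rw [integral_indicator_one hm, Measure.real]
  congr 1
  change (Kernel.traj _ k _) ((fun x : ℕ → S => x (k + 1)) ⁻¹' {r}) = _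
  rw [← Measure.map_apply (measurable_pi_apply _) (.of_discrete),
    ← Kernel.map_apply _ (measurable_pi_apply _), Kernel.map_traj_succ_self, Kernel.comap_apply]
  exact PMF.toMeasure_apply_singleton _ _ .of_discrete

/-- Almost surely the chain only makes transitions of positive probability. -/
theorem ae_leads (P : S → PMF S) (s : S) :
    ∀ᵐ ω ∂chainLaw P s, ∀ k, Leads P (ω k) (ω (k + 1)) := by
  have key : ∀ k r, ∀ᵐ ω ∂chainLaw P s, ω (k + 1) = r → P (ω k) r ≠ 0 := by
    intro k r
    have hm : MeasurableSet {ω : ℕ → S | ω (k + 1) = r} := measurableSet_eval_eq _ _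
    have hint : Integrable ({ω : ℕ → S | ω (k + 1) = r}.indicator (1 : (ℕ → S) → ℝ))
        (chainLaw P s) := (integrable_const (1 : ℝ)).indicator hm
    -- On `E`, the event that the state at time `k` does not lead to `r`, the conditional
    -- probability of moving to `r` vanishes; integrating it over `E` shows that such a move has
    -- probability zero.
    set E : Set (ℕ → S) := {ω | ω k ∈ {t | P t r = 0}} with hE
    have hEm : MeasurableSet[Filtration.piLE (X := fun _ => S) k] E :=
      measurableSet_piLE_eval_mem k _
    have hEm' : MeasurableSet E := (Filtration.piLE (X := fun _ => S)).le k _ hEm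
    have h1 := setIntegral_condExp ((Filtration.piLE (X := fun _ => S)).le k) hint hEm
    have h2 : ∫ ω in E, ((chainLaw P s)[{ω : ℕ → S | ω (k + 1) = r}.indicator
        (1 : (ℕ → S) → ℝ) | Filtration.piLE (X := fun _ => S) k]) ω ∂chainLaw P s = 0 := by
      refine setIntegral_eq_zero_of_ae_eq_zero ?_
      filter_upwards [condExp_chainLaw P s r k] with ω hω hωE
      rw [hω]
      have : P (ω k) r = 0 := hωE
      simp [this]
    rw [h2, setIntegral_indicator hm, Pi.one_def, setIntegral_const, smul_eq_mul, mul_one, eq_comm,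
      measureReal_eq_zero_iff] at h1
    filter_upwards [measure_eq_zero_iff_ae_notMem.1 h1] with ω hω h3 h4
    exact hω ⟨h4, h3⟩
  rw [ae_all_iff]
  intro k
  filter_upwards [ae_all_iff.2 (key k)] with ω hω
  exact hω _ rfl

/-- A state to which the chain can move from an infinitely often visited state is almost surely
visited infinitely often. -/
theorem ae_frequently_of_leads (P : S → PMF S) (s : S) {t r : S} (h : Leads P t r) :
    ∀ᵐ ω ∂chainLaw P s, (∃ᶠ k in atTop, ω k = t) → ∃ᶠ k in atTop, ω k = r := by
  -- Lévy's conditional Borel–Cantelli lemma: `r` is visited infinitely often as soon as the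
  -- conditional probabilities of stepping to `r` have a divergent sum. Each visit to `t`
  -- contributes the same positive amount `P t r`.
  have hbc := ae_mem_limsup_atTop_iff (ℱ := Filtration.piLE (X := fun _ => S)) (chainLaw P s)
    (s := fun k => {ω : ℕ → S | ω k = r}) fun k => measurableSet_piLE_eval_mem k {r}
  filter_upwards [hbc, ae_all_iff.2 (condExp_chainLaw P s r)] with ω hω hce ht
  rw [mem_limsup_iff_frequently_mem] at hω
  refine hω.2 ?_
  simp only [hce]
  have hpos : 0 < (P t r).toReal := ENNReal.toReal_pos h (PMF.apply_ne_top _ _)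
  refine (tendsto_atTop_atTop_iff_of_monotone ?_).2 fun b => ?_
  · exact fun i j hij => Finset.sum_le_sum_of_subset_of_nonneg
      (Finset.range_mono hij) fun _ _ _ => ENNReal.toReal_nonneg
  have hcount : ∀ m : ℕ, ∃ N, m * (P t r).toReal ≤
      ∑ k ∈ Finset.range N, (P (ω k) r).toReal := by
    intro m
    induction m with
    | zero => exact ⟨0, by simp⟩
    | succ m ih =>
      obtain ⟨N, hN⟩ := ih
      obtain ⟨k, hk, hkt⟩ := frequently_atTop.1 ht N
      refine ⟨k + 1, ?_⟩
      rw [Finset.sum_range_succ, hkt]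
      have : ∑ k ∈ Finset.range N, (P (ω k) r).toReal ≤
          ∑ k ∈ Finset.range k, (P (ω k) r).toReal :=
        Finset.sum_le_sum_of_subset_of_nonneg
          (Finset.range_mono hk) fun _ _ _ => ENNReal.toReal_nonneg
      push_cast
      linarith
  obtain ⟨m, hm⟩ := exists_nat_ge (b / (P t r).toReal)
  obtain ⟨N, hN⟩ := hcount m
  exact ⟨N, ((div_le_iff₀ hpos).1 hm).trans hN⟩

theorem ae_frequently_of_reaches (P : S → PMF S) (s : S) {t r : S}
    (h : Relation.ReflTransGen (Leads P) t r) :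
    ∀ᵐ ω ∂chainLaw P s, (∃ᶠ k in atTop, ω k = t) → ∃ᶠ k in atTop, ω k = r := by
  induction h with
  | refl => exact .of_forall fun _ => id
  | tail _ h ih =>
    filter_upwards [ih, ae_frequently_of_leads P s h] with ω h1 h2 h3 using h2 (h1 h3)

/-- In a finite chain in which every state leads to `m`, the recurrent states are those that can
be reached from `m`. -/
theorem isRecurrentState_iff [Finite S] (P : S → PMF S) (m : S)
    (hm : ∀ t, Relation.ReflTransGen (Leads P) t m) (s : S) :
    IsRecurrentState P s ↔ Relation.ReflTransGen (Leads P) m s := by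
  constructor
  · intro hs
    -- A typical trajectory visits `s` infinitely often, hence also `m`; its segment from a visit to
    -- `m` to a later visit to `s` consists of possible transitions.
    obtain ⟨ω, h1, h2, h3⟩ :=
      (hs.and ((ae_frequently_of_reaches P s (hm s)).and (ae_leads P s))).exists
    obtain ⟨k, -, hk⟩ := frequently_atTop.1 (h2 h1) 0
    obtain ⟨l, hl, hls⟩ := frequently_atTop.1 h1 k
    rw [← hk, ← hls]
    exact Nat.rel_of_forall_rel_succ_of_le (Relation.ReflTransGen (Leads P))
      (fun n => .single (h3 n)) hl
  · intro hs
    have h : ∀ᵐ ω ∂chainLaw P s, ∀ t, (∃ᶠ k in atTop, ω k = t) → ∃ᶠ k in atTop, ω k = s :=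
      ae_all_iff.2 fun t => ae_frequently_of_reaches P s ((hm t).trans hs)
    filter_upwards [h] with ω hω
    -- By finiteness some `t` is visited infinitely often, and `t` leads to `s` through `m`.
    obtain ⟨t, ht⟩ : ∃ t, ∃ᶠ k in atTop, ω k = t := by
      obtain ⟨t, ht⟩ := Finite.exists_infinite_fiber ω
      exact ⟨t, Nat.frequently_atTop_iff_infinite.2 (Set.infinite_coe_iff.1 ht)⟩
    exact hω t ht

end Recurrence

end Sandpile

namespace Sandpile

/-! ### Legal topplings and the abelian property -/

section Abelian

set_option linter.unusedSectionVars false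

variable {V : Type*} [Fintype V] [DecidableEq V]

/-- The subtraction in `sendGrains` is truncated; the bound on `A.card` makes it exact, so extra
grains do not interfere. -/
theorem sendGrains_add {c : V → ℕ} {i : V} {A : Finset (Option V)} (hA : A.card ≤ c i)
    (e : V → ℕ) : sendGrains (c + e) i A = sendGrains c i A + e := by
  funext v
  simp only [sendGrains, Pi.add_apply]
  split_ifs with h
  all_goals first | omega | (subst h; omega)

theorem sendGrains_comm {c : V → ℕ} {i j : V} (hij : i ≠ j) {A B : Finset (Option V)}
    (hA : A.card ≤ c i) (hB : B.card ≤ c j) :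
    sendGrains (sendGrains c i A) j B = sendGrains (sendGrains c j B) i A := by
  funext v
  simp only [sendGrains]
  by_cases hi : v = i
  · subst hi
    simp only [if_true, if_neg hij]
    omega
  · by_cases hj : v = j
    · subst hj
      simp only [if_true, if_neg hi]
      omega
    · simp only [if_neg hi, if_neg hj]
      omega

theorem le_sendGrains {c : V → ℕ} {i j : V} (hij : j ≠ i) (A : Finset (Option V)) :
    c j ≤ sendGrains c i A j := by
  simp [sendGrains, hij]

variable (G : SimpleGraph (Option V)) [DecidableRel G.Adj]

/-- `LegalPath G 𝒜 k c d`: the configuration `d` arises from `c` by `k` topplings of unstable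
vertices, where a vertex `i` may send one grain to each element of any `A` with `𝒜 i A`. -/
inductive LegalPath (𝒜 : V → Finset (Option V) → Prop) : ℕ → (V → ℕ) → (V → ℕ) → Prop
  | nil (c : V → ℕ) : LegalPath 𝒜 0 c c
  | cons {k : ℕ} {c d : V → ℕ} {i : V} {A : Finset (Option V)} (hA : 𝒜 i A)
      (hi : G.degree (some i) ≤ c i) (h : LegalPath 𝒜 k (sendGrains c i A) d) :
      LegalPath 𝒜 (k + 1) c d

/-- A vertex sends a grain to each of its neighbours. -/
def FullToppling (i : V) (A : Finset (Option V)) : Prop := A = G.neighborFinset (some i)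

/-- A vertex sends a grain to each vertex in some set of neighbours. -/
def PartialToppling (i : V) (A : Finset (Option V)) : Prop := A ⊆ G.neighborFinset (some i)

/-- `d` arises from `c` by toppling the unstable vertex chosen by the rule `r`. -/
def RuleStep (𝒜 : V → Finset (Option V) → Prop) (r : TopplingRule G) (c d : V → ℕ) : Prop :=
  ¬ IsStable G c ∧ ∃ A, 𝒜 (r.select c) A ∧ d = sendGrains c (r.select c) A

/-- The largest stable configuration. -/
def maxStable (v : V) : ℕ := G.degree (some v) - 1

variable {G} {𝒜 : V → Finset (Option V) → Prop}

namespace LegalPath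

theorem trans {k l : ℕ} {c d e : V → ℕ} (h : LegalPath G 𝒜 k c d) (h' : LegalPath G 𝒜 l d e) :
    ∃ m, LegalPath G 𝒜 m c e := by
  induction h with
  | nil => exact ⟨l, h'⟩
  | cons hA hi _ ih => exact (ih h').imp' _ fun _ => cons hA hi

theorem single {c : V → ℕ} {i : V} {A : Finset (Option V)} (hA : 𝒜 i A)
    (hi : G.degree (some i) ≤ c i) : LegalPath G 𝒜 1 c (sendGrains c i A) :=
  cons hA hi (nil _)

theorem mono {ℬ : V → Finset (Option V) → Prop} (h : ∀ i A, 𝒜 i A → ℬ i A) {k : ℕ}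
    {c d : V → ℕ} (hp : LegalPath G 𝒜 k c d) : LegalPath G ℬ k c d := by
  induction hp with
  | nil => exact nil _
  | cons hA hi _ ih => exact cons (h _ _ hA) hi ih

theorem card_le (h𝒜 : ∀ i A, 𝒜 i A → A ⊆ G.neighborFinset (some i)) {c : V → ℕ} {i : V}
    {A : Finset (Option V)} (hA : 𝒜 i A) (hi : G.degree (some i) ≤ c i) : A.card ≤ c i :=
  (Finset.card_le_card (h𝒜 i A hA)).trans
    (by rwa [SimpleGraph.card_neighborFinset_eq_degree])

theorem add (h𝒜 : ∀ i A, 𝒜 i A → A ⊆ G.neighborFinset (some i)) {k : ℕ} {c d : V → ℕ}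
    (h : LegalPath G 𝒜 k c d) (e : V → ℕ) : LegalPath G 𝒜 k (c + e) (d + e) := by
  induction h with
  | nil => exact nil _
  | cons hA hi _ ih =>
    refine cons hA (hi.trans (Nat.le_add_right _ _)) ?_
    rwa [sendGrains_add (card_le h𝒜 hA hi)]

theorem eq_of_isStable {k : ℕ} {c d : V → ℕ} (hc : IsStable G c) (h : LegalPath G 𝒜 k c d) :
    d = c := by
  cases h with
  | nil => rfl
  | cons _ hi _ => exact absurd (hc _) hi.not_gt

/-- In a sequence of topplings that leads to a stable configuration, any vertex that is unstable
at the beginning may be the first to topple. -/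
theorem exchange (h𝒜 : ∀ i A, 𝒜 i A → A ⊆ G.neighborFinset (some i)) {k : ℕ} {c s : V → ℕ}
    (h : LegalPath G 𝒜 k c s) (hs : IsStable G s) {i : V} (hi : G.degree (some i) ≤ c i) :
    ∃ m A, k = m + 1 ∧ 𝒜 i A ∧ LegalPath G 𝒜 m (sendGrains c i A) s := by
  induction h with
  | nil => exact absurd (hs i) hi.not_gt
  | @cons k c d j B hB hj hp ih =>
    by_cases hij : i = j
    · subst hij
      exact ⟨k, B, rfl, hB, hp⟩
    · obtain ⟨m, A, rfl, hA, hm⟩ := ih hs (hi.trans (le_sendGrains hij B))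
      refine ⟨m + 1, A, rfl, hA, cons hB (hj.trans (le_sendGrains (Ne.symm hij) A)) ?_⟩
      rwa [sendGrains_comm hij (card_le h𝒜 hA hi) (card_le h𝒜 hB hj)]

/-- Extra grains may be set aside until the remaining ones have been stabilised, in the order
prescribed by any rule. -/
theorem exists_ruleStep (h𝒜 : ∀ i A, 𝒜 i A → A ⊆ G.neighborFinset (some i))
    (r : TopplingRule G) (e : V → ℕ) {s : V → ℕ} (hs : IsStable G s) {k : ℕ} {u : V → ℕ}
    (h : LegalPath G 𝒜 k (u + e) s) :
    ∃ t, IsStable G t ∧ Relation.ReflTransGen (RuleStep G 𝒜 r) u t ∧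
      ∃ m, LegalPath G 𝒜 m (t + e) s := by
  induction k generalizing u with
  | zero =>
    cases h
    refine ⟨u, fun v => lt_of_le_of_lt (Nat.le_add_right _ _) (hs v), .refl, 0, nil _⟩
  | succ k ih =>
    by_cases hu : IsStable G u
    · exact ⟨u, hu, .refl, k + 1, h⟩
    · have hsel := r.unstable_select u hu
      -- The vertex selected in `u` is also unstable in `u + e`, so its toppling can be moved to the
      -- front.
      obtain ⟨m, A, hm, hA, hp⟩ := h.exchange h𝒜 hs (hsel.trans (Nat.le_add_right _ (e _)))
      obtain rfl : m = k := by omega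
      rw [sendGrains_add (card_le h𝒜 hA hsel)] at hp
      obtain ⟨t, ht, hut, hts⟩ := ih hp
      exact ⟨t, ht, .head ⟨hu, A, hA, rfl⟩ hut, hts⟩

theorem of_ruleStep {r : TopplingRule G} {c d : V → ℕ}
    (h : Relation.ReflTransGen (RuleStep G 𝒜 r) c d) : ∃ k, LegalPath G 𝒜 k c d := by
  induction h with
  | refl => exact ⟨0, nil _⟩
  | tail _ h ih =>
    obtain ⟨hs, A, hA, rfl⟩ := h
    obtain ⟨k, hk⟩ := ih
    exact hk.trans (single hA (r.unstable_select _ hs))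

theorem exists_of_topples {c d : V → ℕ} (h : Relation.ReflTransGen (Topples G) c d) :
    ∃ k, LegalPath G (FullToppling G) k c d := by
  induction h with
  | refl => exact ⟨0, nil _⟩
  | tail _ h ih =>
    obtain ⟨i, hi, rfl⟩ := h
    obtain ⟨k, hk⟩ := ih
    exact hk.trans (single rfl hi)

/-- Full topplings lead to at most one stable configuration. -/
theorem stable_unique {k l : ℕ} {c s t : V → ℕ} (hs : LegalPath G (FullToppling G) k c s)
    (ht : LegalPath G (FullToppling G) l c t) (hs' : IsStable G s) (ht' : IsStable G t) :
    s = t := by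
  induction hs generalizing l with
  | nil c => exact (ht.eq_of_isStable hs').symm
  | cons hA hi _ ih =>
    obtain ⟨m, B, -, hB, hp⟩ := ht.exchange (fun i A h => h.subset) ht' hi
    obtain rfl := hA.trans hB.symm
    exact ih hp hs'

end LegalPath

theorem isStable_maxStable (hG : ∀ v, G.Adj (some v) none) : IsStable G (maxStable G) := by
  intro v
  have : 0 < G.degree (some v) := (G.degree_pos_iff_exists_adj _).2 ⟨none, hG v⟩
  simp only [maxStable]
  omega

theorem IsStable.le_maxStable {c : V → ℕ} (hc : IsStable G c) : c ≤ maxStable G := fun v => by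
  have := hc v
  simp only [maxStable]
  omega

/-- If the moves of a chain on stable configurations are to add a grain and stabilise, then `t`
leads to every stable configuration into which `t + e` can be stabilised. -/
theorem reaches_of_legalPath (h𝒜 : ∀ i A, 𝒜 i A → A ⊆ G.neighborFinset (some i))
    (r : TopplingRule G) {L : StableConfig G → StableConfig G → Prop}
    (hL : ∀ (t t' : StableConfig G) (i : V),
      Relation.ReflTransGen (RuleStep G 𝒜 r) (addGrain t i) t' → L t t')
    (s : StableConfig G) (N : ℕ) : ∀ (t : StableConfig G) (e : V → ℕ), ∑ v, e v = N →
      ∀ k, LegalPath G 𝒜 k (t + e) s → Relation.ReflTransGen L t s := by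
  induction N with
  | zero =>
    intro t e he k h
    have : e = 0 := by
      funext v
      exact (Finset.sum_eq_zero_iff.1 he) v (Finset.mem_univ v)
    rw [this, add_zero] at h
    rw [Subtype.ext (h.eq_of_isStable t.2)]
  | succ N ih =>
    intro t e he k h
    obtain ⟨i, hi⟩ : ∃ i, e i ≠ 0 := by
      by_contra! hcon
      simp [hcon] at he
    have hle : Pi.single i 1 ≤ e := by
      intro v
      by_cases hv : v = i
      · subst hv; simpa [Nat.one_le_iff_ne_zero] using hi
      · simp [hv]
    have hsplit : (t : V → ℕ) + e = addGrain t i + (e - Pi.single i 1) := by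
      rw [addGrain, add_assoc, add_tsub_cancel_of_le hle]
    rw [hsplit] at h
    obtain ⟨t', ht', hr, m, hm⟩ := h.exists_ruleStep h𝒜 r _ s.2
    refine .head (hL t ⟨t', ht'⟩ i hr) (ih ⟨t', ht'⟩ _ ?_ m hm)
    have h1 : ∑ v, (e - Pi.single i 1 : V → ℕ) v + ∑ v, (Pi.single i 1 : V → ℕ) v = ∑ v, e v := by
      rw [← Finset.sum_add_distrib]
      exact Finset.sum_congr rfl fun v _ => tsub_add_cancel_of_le (hle v)
    rw [Finset.sum_pi_single'] at h1
    simp only [Finset.mem_univ, if_true] at h1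
    omega

/-- All grains added along the way may be present from the start, since extra grains never make a
toppling illegal. -/
theorem exists_legalPath_of_reaches (h𝒜 : ∀ i A, 𝒜 i A → A ⊆ G.neighborFinset (some i))
    {L : StableConfig G → StableConfig G → Prop}
    (hL : ∀ t t', L t t' → ∃ i k, LegalPath G 𝒜 k (addGrain t i) t') {t s : StableConfig G}
    (h : Relation.ReflTransGen L t s) : ∃ e k, LegalPath G 𝒜 k (t + e) s := by
  induction h with
  | refl => exact ⟨0, 0, by rw [add_zero]; exact .nil _⟩
  | tail _ h ih =>
    obtain ⟨e, k, hk⟩ := ih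
    obtain ⟨i, l, hl⟩ := hL _ _ h
    exact ⟨e + Pi.single i 1, by
      rw [← add_assoc]
      exact (hk.add h𝒜 (Pi.single i 1)).trans hl⟩

theorem reaches_maxStable (hG : ∀ v, G.Adj (some v) none)
    (h𝒜 : ∀ i A, 𝒜 i A → A ⊆ G.neighborFinset (some i))
    (r : TopplingRule G) {L : StableConfig G → StableConfig G → Prop}
    (hL : ∀ (t t' : StableConfig G) (i : V),
      Relation.ReflTransGen (RuleStep G 𝒜 r) (addGrain t i) t' → L t t')
    (t : StableConfig G) : Relation.ReflTransGen L t ⟨maxStable G, isStable_maxStable hG⟩ := by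
  -- Adding the missing grains `maxStable G - t` requires no toppling at all.
  refine reaches_of_legalPath h𝒜 r hL _ _ t (maxStable G - t) rfl 0 ?_
  rw [add_tsub_cancel_of_le t.2.le_maxStable]
  exact .nil _

/-! ### The recurrence criterion in the two models -/

instance finite_stableConfig : Finite (StableConfig G) :=
  Set.Finite.to_subtype ((Set.finite_Iic (maxStable G)).subset fun _ hc =>
    IsStable.le_maxStable hc)

/-- The recurrence criterion shared by both models. -/
theorem isRecurrentState_iff_legalPath (hG : ∀ v, G.Adj (some v) none)
    (h𝒜 : ∀ i A, 𝒜 i A → A ⊆ G.neighborFinset (some i))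
    (r : TopplingRule G) (P : StableConfig G → PMF (StableConfig G))
    (hP : ∀ (t t' : StableConfig G) (i : V),
      Relation.ReflTransGen (RuleStep G 𝒜 r) (addGrain t i) t' → Leads P t t')
    (hP' : ∀ t t', Leads P t t' → ∃ i k, LegalPath G 𝒜 k (addGrain t i) t')
    (s : StableConfig G) :
    IsRecurrentState P s ↔ ∃ e k, LegalPath G 𝒜 k (maxStable G + e) s := by
  rw [isRecurrentState_iff P ⟨maxStable G, isStable_maxStable hG⟩
    (reaches_maxStable hG h𝒜 r hP)]
  constructor
  · exact exists_legalPath_of_reaches h𝒜 hP'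
  · rintro ⟨e, k, h⟩
    exact reaches_of_legalPath h𝒜 r hP s _ ⟨maxStable G, isStable_maxStable hG⟩ e rfl k h

/-- The rule `r` is auxiliary: by `stable_unique`, stabilising in its order gives the same result as
`asmStabilise`. -/
theorem isASMRecurrent_iff (hG : ∀ v, G.Adj (some v) none) (r : TopplingRule G) {μ : PMF V}
    (hμ : ∀ i, μ i ≠ 0) (c : V → ℕ) :
    IsASMRecurrent hG μ c ↔
      IsStable G c ∧ ∃ e k, LegalPath G (FullToppling G) k (maxStable G + e) c := by
  have hstab : ∀ c, ∃ k, LegalPath G (FullToppling G) k c (asmStabilise hG c) := fun c =>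
    LegalPath.exists_of_topples (exists_stabilisation hG c).choose_spec
  have hLeads : ∀ t t', Leads (asmStep hG μ) t t' ↔
      ∃ i, t' = asmStabilise hG (addGrain t i) := by
    intro t t'
    rw [Leads, asmStep, ← PMF.mem_support_iff, PMF.mem_support_map_iff]
    simp [PMF.mem_support_iff, hμ, eq_comm]
  have key := isRecurrentState_iff_legalPath hG (fun i A h => h.subset) r (asmStep hG μ)
    (𝒜 := FullToppling G)
    (fun t t' i h => by
      obtain ⟨k, hk⟩ := LegalPath.of_ruleStep h
      obtain ⟨l, hl⟩ := hstab (addGrain t i)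
      exact (hLeads t t').2 ⟨i, Subtype.ext (hk.stable_unique hl t'.2 (Subtype.property _))⟩)
    (fun t t' h => by
      obtain ⟨i, rfl⟩ := (hLeads t t').1 h
      exact ⟨i, hstab _⟩)
  constructor
  · rintro ⟨hc, h⟩
    exact ⟨hc, (key _).1 h⟩
  · rintro ⟨hc, h⟩
    exact ⟨hc, (key ⟨c, hc⟩).2 h⟩

theorem exists_iterLaw_ne_zero_iff {α : Type*} (T : α → PMF α) (a b : α) :
    (∃ k, iterLaw T k a b ≠ 0) ↔ Relation.ReflTransGen (fun x y => T x y ≠ 0) a b := by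
  constructor
  · rintro ⟨k, hk⟩
    induction k generalizing a with
    | zero =>
      rw [iterLaw, ← PMF.mem_support_iff, PMF.mem_support_pure_iff] at hk
      rw [hk]
    | succ k ih =>
      rw [iterLaw, ← PMF.mem_support_iff, PMF.mem_support_bind_iff] at hk
      obtain ⟨x, hx, hb⟩ := hk
      exact .head hx (ih x hb)
  · intro h
    induction h using Relation.ReflTransGen.head_induction_on with
    | refl => exact ⟨0, by simp [iterLaw]⟩
    | head h _ ih =>
      obtain ⟨k, hk⟩ := ih
      refine ⟨k + 1, ?_⟩
      rw [iterLaw, ← PMF.mem_support_iff, PMF.mem_support_bind_iff]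
      exact ⟨_, h, hk⟩

theorem randomSubset_ne_zero_iff {β : Type*} [DecidableEq β] (p : Set.Ioo (0 : ℝ) 1)
    (N A : Finset β) : randomSubset p N A ≠ 0 ↔ A ⊆ N := by
  by_cases h : A ⊆ N
  · simp [randomSubset, h, p.2.1, p.2.2]
  · simp [randomSubset, h]

theorem ssmTopple_ne_zero_iff (p : Set.Ioo (0 : ℝ) 1) (r : TopplingRule G) (c d : V → ℕ) :
    ssmTopple p r c d ≠ 0 ↔ (IsStable G c ∧ d = c) ∨ RuleStep G (PartialToppling G) r c d := by
  rw [← PMF.mem_support_iff, ssmTopple, RuleStep]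
  by_cases hc : IsStable G c
  · simp [hc]
  · rw [if_neg hc, PMF.mem_support_map_iff]
    simp only [PMF.mem_support_iff, randomSubset_ne_zero_iff, hc, false_and, false_or,
      not_false_eq_true, true_and, PartialToppling]
    exact exists_congr fun A => and_congr_right fun _ => eq_comm

theorem ssmStabilise_ne_zero_iff (hG : ∀ v, G.Adj (some v) none) (p : Set.Ioo (0 : ℝ) 1)
    (r : TopplingRule G) (c : V → ℕ) (s : StableConfig G) :
    ssmStabilise hG p r c s ≠ 0 ↔
      Relation.ReflTransGen (RuleStep G (PartialToppling G) r) c s := by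
  have h1 : ssmStabilise hG p r c s = ⨆ k, iterLaw (ssmTopple p r) k c s := rfl
  rw [h1, ← bot_eq_zero, Ne, iSup_eq_bot, not_forall]
  refine (exists_iterLaw_ne_zero_iff (ssmTopple p r) c s).trans ⟨fun h => ?_, fun h => ?_⟩
  · generalize (s : V → ℕ) = d at h ⊢
    induction h with
    | refl => exact .refl
    | tail _ h ih =>
      rcases (ssmTopple_ne_zero_iff p r _ _).1 h with ⟨-, rfl⟩ | h
      · exact ih
      · exact ih.tail h
  · exact Relation.ReflTransGen.mono (fun a b hab => (ssmTopple_ne_zero_iff p r a b).2 (.inr hab)) _ _ h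

theorem isSSMRecurrent_iff (hG : ∀ v, G.Adj (some v) none) (p : Set.Ioo (0 : ℝ) 1)
    (r : TopplingRule G) {μ : PMF V} (hμ : ∀ i, μ i ≠ 0) (c : V → ℕ) :
    IsSSMRecurrent hG p r μ c ↔
      IsStable G c ∧ ∃ e k, LegalPath G (PartialToppling G) k (maxStable G + e) c := by
  have hLeads : ∀ t t', Leads (ssmStep hG p r μ) t t' ↔
      ∃ i, Relation.ReflTransGen (RuleStep G (PartialToppling G) r) (addGrain t i) t' := by
    intro t t'
    rw [Leads, ssmStep, ← PMF.mem_support_iff, PMF.mem_support_bind_iff]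
    simp only [PMF.mem_support_iff, ssmStabilise_ne_zero_iff, hμ, ne_eq, not_false_eq_true,
      true_and]
  have key := isRecurrentState_iff_legalPath hG (fun i A h => h) r (ssmStep hG p r μ)
    (𝒜 := PartialToppling G)
    (fun t t' i h => (hLeads t t').2 ⟨i, h⟩)
    (fun t t' h => by
      obtain ⟨i, hi⟩ := (hLeads t t').1 h
      exact ⟨i, LegalPath.of_ruleStep hi⟩)
  constructor
  · rintro ⟨hc, h⟩
    exact ⟨hc, (key _).1 h⟩
  · rintro ⟨hc, h⟩
    exact ⟨hc, (key ⟨c, hc⟩).2 h⟩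

end Abelian

end Sandpile

namespace Sandpile

/-! ### Orientations of the cycle as an invariant of toppling -/

section Wheel

open scoped Fin.CommRing

variable {n : ℕ}

theorem neighborFinset_wheelGraph (i : Fin (n + 3)) :
    (wheelGraph (n + 3)).neighborFinset (some i) = {none, some (i - 1), some (i + 1)} := by
  ext (_ | j)
  · rw [SimpleGraph.mem_neighborFinset]
    exact iff_of_true trivial (by simp)
  · simp only [SimpleGraph.mem_neighborFinset, Finset.mem_insert, reduceCtorEq, Option.some.injEq,
      Finset.mem_singleton, false_or]
    change (SimpleGraph.cycleGraph (n + 3)).Adj i j ↔ _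
    rw [← SimpleGraph.mem_neighborSet, SimpleGraph.cycleGraph_neighborSet]
    simp

theorem add_one_ne (i : Fin (n + 3)) : i + 1 ≠ i := by
  simp

theorem sub_one_ne (i : Fin (n + 3)) : i - 1 ≠ i := by
  simp

theorem sub_one_ne_add_one (i : Fin (n + 3)) : i - 1 ≠ i + 1 := by
  simp only [ne_eq, sub_eq_iff_eq_add, add_assoc i, left_eq_add]
  exact ne_of_beq_false rfl

theorem degree_wheelGraph (i : Fin (n + 3)) : (wheelGraph (n + 3)).degree (some i) = 3 := by
  rw [← SimpleGraph.card_neighborFinset_eq_degree, neighborFinset_wheelGraph,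
    Finset.card_insert_of_notMem (by simp),
    Finset.card_insert_of_notMem (by simpa using sub_one_ne_add_one i), Finset.card_singleton]

theorem isStable_wheelGraph_iff (c : Fin (n + 3) → ℕ) :
    IsStable (wheelGraph (n + 3)) c ↔ ∀ i, c i ≤ 2 := by
  simp only [IsStable, degree_wheelGraph]
  exact forall_congr' fun i => Nat.lt_succ_iff

theorem maxStable_wheelGraph : maxStable (wheelGraph (n + 3)) = fun _ => 2 := by
  funext i
  simp only [maxStable, degree_wheelGraph]

/-- The in-degrees of the orientation of the cycle in which the edge between `i` and `i + 1`
points to `i + 1` if `x i` holds, and to `i` otherwise. -/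
def cycleInDegree (x : Fin (n + 3) → Bool) (i : Fin (n + 3)) : ℕ :=
  (x (i - 1)).toNat + (!x i).toNat

/-- The orientation of the cycle is acyclic. -/
def IsAcyclicOrientation (x : Fin (n + 3) → Bool) : Prop := ∃ i j, x i ≠ x j

theorem cycleInDegree_le_two (x : Fin (n + 3) → Bool) (i : Fin (n + 3)) :
    cycleInDegree x i ≤ 2 := by
  have := (x (i - 1)).toNat_le
  have := (!x i).toNat_le
  simp only [cycleInDegree]
  omega

theorem isStable_cycleInDegree (x : Fin (n + 3) → Bool) :
    IsStable (wheelGraph (n + 3)) (cycleInDegree x) :=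
  (isStable_wheelGraph_iff _).2 (cycleInDegree_le_two x)

theorem sum_cycleInDegree (x : Fin (n + 3) → Bool) : ∑ i, cycleInDegree x i = n + 3 := by
  have h : ∑ i, (x (i - 1)).toNat = ∑ i, (x i).toNat :=
    Equiv.sum_comp (Equiv.subRight 1) fun i => (x i).toNat
  simp only [cycleInDegree, Finset.sum_add_distrib, h]
  rw [← Finset.sum_add_distrib, Finset.sum_congr rfl (g := fun _ => 1)]
  · simp
  · intro i _
    cases x i <;> rfl

theorem cycleInDegree_not (x : Fin (n + 3) → Bool) (i : Fin (n + 3)) :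
    cycleInDegree (fun j => !x j) i + cycleInDegree x i = 2 := by
  simp only [cycleInDegree]
  cases x (i - 1) <;> cases x i <;> rfl

/-- When a vertex topples, the edges along which it sends grains may be made to point away
from it. -/
theorem exists_cycleInDegree_le_sendGrains {c : Fin (n + 3) → ℕ} {x : Fin (n + 3) → Bool}
    (hx : cycleInDegree x ≤ c) {i : Fin (n + 3)} {A : Finset (Option (Fin (n + 3)))}
    (hA : A ⊆ (wheelGraph (n + 3)).neighborFinset (some i)) (hi : 3 ≤ c i) :
    ∃ y, cycleInDegree y ≤ sendGrains c i A ∧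
      (A = (wheelGraph (n + 3)).neighborFinset (some i) → IsAcyclicOrientation y) := by
  have e1 := add_one_ne i
  have e2 := sub_one_ne i
  have e3 := sub_one_ne_add_one i
  rw [neighborFinset_wheelGraph] at hA ⊢
  -- The edges from `i` to its cycle neighbours in `A` are turned away from `i`; all others are
  -- kept.
  set y : Fin (n + 3) → Bool := fun v =>
    if v = i - 1 then x v && !decide (some (i - 1) ∈ A)
    else if v = i then x v || decide (some (i + 1) ∈ A) else x v with hy
  have y1 : y (i - 1) = (x (i - 1) && !decide (some (i - 1) ∈ A)) := by simp [hy]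
  have y2 : y i = (x i || decide (some (i + 1) ∈ A)) := by simp [hy, e2.symm]
  have y3 : ∀ v, v ≠ i → v ≠ i - 1 → y v = x v := fun v h1 h2 => by simp [hy, h1, h2]
  clear_value y
  refine ⟨y, fun v => ?_, ?_⟩
  · have hv := hx v
    have hiA : some i ∉ A := fun h => by
      have := hA h
      simp [e2.symm, e1.symm] at this
    by_cases hvi : v = i
    · subst hvi
      -- The toppled vertex keeps at least `3 - A.card` grains. This suffices: at most one grain
      -- goes to the sink, and each other grain sent accounts for an edge no longer pointing to the
      -- vertex.
      have hcard : A.card ≤ 1 + (if some (v - 1) ∈ A then 1 else 0) +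
          (if some (v + 1) ∈ A then 1 else 0) := by
        have h1 : A ⊆ insert none ((if some (v - 1) ∈ A then {some (v - 1)} else ∅) ∪
            (if some (v + 1) ∈ A then {some (v + 1)} else ∅)) := by
          intro w hw
          have := hA hw
          simp only [Finset.mem_insert, Finset.mem_singleton] at this
          rcases this with rfl | rfl | rfl <;> simp [hw]
        refine (Finset.card_le_card h1).trans ((Finset.card_insert_le _ _).trans ?_)
        have := Finset.card_union_le (if some (v - 1) ∈ A then {some (v - 1)} else ∅)
            (if some (v + 1) ∈ A then {some (v + 1)} else ∅)
        have hc : ∀ w, (if w ∈ A then ({w} : Finset (Option (Fin (n + 3)))) else ∅).card =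
            if w ∈ A then 1 else 0 := fun w => by split_ifs <;> rfl
        rw [hc, hc] at this
        omega
      simp only [cycleInDegree, sendGrains, if_true, y1, y2, if_neg hiA]
      generalize x (v - 1) = a
      generalize x v = b
      by_cases h1 : some (v - 1) ∈ A <;> by_cases h2 : some (v + 1) ∈ A <;>
        simp only [h1, h2, if_true, if_false, decide_true, decide_false] at hcard ⊢ <;>
        cases a <;> cases b <;> simp <;> omega
    · simp only [sendGrains, if_neg hvi]
      by_cases hv1 : v = i + 1
      · subst hv1
        simp only [cycleInDegree, add_sub_cancel_right] at hv ⊢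
        rw [y2, y3 _ e1 e3.symm]
        by_cases h2 : some (i + 1) ∈ A
        · simp only [h2, if_true, decide_true, Bool.or_true, Bool.toNat_true]
          omega
        · simpa [h2] using hv
      · have h1 : v - 1 ≠ i := fun h => hv1 (sub_eq_iff_eq_add.1 h)
        have h2 : v - 1 ≠ i - 1 := fun h => hvi (sub_left_injective h)
        simp only [cycleInDegree] at hv ⊢
        rw [y3 _ h1 h2]
        by_cases hv2 : v = i - 1
        · subst hv2
          rw [y1]
          by_cases h3 : some (i - 1) ∈ A
          · simp only [h3, if_true, decide_true, Bool.not_true, Bool.and_false, Bool.not_false,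
              Bool.toNat_true]
            omega
          · simpa [h3] using hv
        · rw [y3 _ hvi hv2]
          omega
  -- After a full toppling both edges at `i` point away from it, so `y` differs at `i` and `i - 1`.
  · rintro rfl
    exact ⟨i, i - 1, by simp [y1, y2]⟩

theorem exists_cycleInDegree_le_of_partial {k : ℕ} {c d : Fin (n + 3) → ℕ}
    (h : LegalPath (wheelGraph (n + 3)) (PartialToppling (wheelGraph (n + 3))) k c d)
    (hc : ∃ x, cycleInDegree x ≤ c) : ∃ x, cycleInDegree x ≤ d := by
  induction h with
  | nil => exact hc
  | cons hA hi _ ih =>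
    obtain ⟨x, hx⟩ := hc
    obtain ⟨y, hy, -⟩ := exists_cycleInDegree_le_sendGrains hx hA (by rwa [degree_wheelGraph] at hi)
    exact ih ⟨y, hy⟩

theorem exists_cycleInDegree_le_of_full {k : ℕ} {c d : Fin (n + 3) → ℕ}
    (h : LegalPath (wheelGraph (n + 3)) (FullToppling (wheelGraph (n + 3))) k c d)
    (hc : ∃ x, IsAcyclicOrientation x ∧ cycleInDegree x ≤ c) :
    ∃ x, IsAcyclicOrientation x ∧ cycleInDegree x ≤ d := by
  induction h with
  | nil => exact hc
  | cons hA hi _ ih =>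
    obtain ⟨x, -, hx⟩ := hc
    obtain ⟨y, hy, hy'⟩ := exists_cycleInDegree_le_sendGrains hx hA.subset
      (by rwa [degree_wheelGraph] at hi)
    exact ih ⟨y, hy' hA, hy⟩

/-! ### Burning: in-degree vectors are recurrent -/

theorem cycle_induction {P : Fin (n + 3) → Prop} {i : Fin (n + 3)} (hi : P i)
    (h : ∀ j, P j → P (j + 1)) (j : Fin (n + 3)) : P j := by
  have key : ∀ k : ℕ, P (i + (k : Fin (n + 3))) := by
    intro k
    induction k with
    | zero => simpa using hi
    | succ k ih =>
      rw [Nat.cast_succ, ← add_assoc]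
      exact h _ ih
  have := key (j - i).val
  rwa [Fin.cast_val_eq_self, add_sub_cancel] at this

theorem cycle_induction_sub {P : Fin (n + 3) → Prop} {i : Fin (n + 3)} (hi : P i)
    (h : ∀ j, P j → P (j - 1)) (j : Fin (n + 3)) : P j := by
  have := cycle_induction (P := fun j => P (-j)) (i := -i) (by simpa using hi)
    (fun j hj => by
      have := h _ hj
      rwa [neg_add, ← sub_eq_add_neg]) (-j)
  simpa using this

/-- Dhar's burning algorithm does not stop before all vertices are burnt. -/
theorem exists_burnable {x : Fin (n + 3) → Bool} (hx : IsAcyclicOrientation x)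
    {T : Finset (Fin (n + 3))} (hT : T ≠ Finset.univ) :
    ∃ i ∉ T, 2 ≤ cycleInDegree x i + (if i - 1 ∈ T then 1 else 0) +
      (if i + 1 ∈ T then 1 else 0) := by
  by_contra! hcon
  simp only [cycleInDegree] at hcon
  obtain ⟨a, b, hab⟩ := hx
  -- If an edge points clockwise to an unburnt vertex that cannot burn, then the next edge points
  -- clockwise to an unburnt vertex too. Going round, the orientation is a directed cycle. `hdown`
  -- is the anticlockwise version.
  have hup : ∀ i, x i = true ∧ i + 1 ∉ T → False := by
    intro i hi
    have := cycle_induction (P := fun i => x i = true ∧ i + 1 ∉ T) hi (fun j hj => by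
      have h := hcon _ hj.2
      rw [add_sub_cancel_right, hj.1] at h
      cases h1 : x (j + 1) <;> by_cases h2 : j + 1 + 1 ∈ T <;> simp_all <;> omega)
    exact hab ((this a).1.trans (this b).1.symm)
  have hdown : ∀ i, x i = false ∧ i ∉ T → False := by
    intro i hi
    have := cycle_induction_sub (P := fun i => x i = false ∧ i ∉ T) hi (fun j hj => by
      have h := hcon _ hj.2
      rw [hj.1] at h
      cases h1 : x (j - 1) <;> by_cases h2 : j - 1 ∈ T <;> simp_all <;> omega)
    exact hab ((this a).1.trans (this b).1.symm)
  obtain ⟨i, hi⟩ : ∃ i, i ∉ T := by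
    by_contra! h
    exact hT (Finset.eq_univ_iff_forall.2 h)
  have h := hcon i hi
  have h1 := hup i
  have h2 := hdown (i - 1)
  have h3 := hdown i
  cases h4 : x i <;> cases h5 : x (i - 1) <;> by_cases h6 : i + 1 ∈ T <;>
    by_cases h7 : i - 1 ∈ T <;> simp_all

/-- Here `d` is the state after the sink has given one grain to each vertex and the vertices of `T`
have toppled once each. A burnable vertex then holds at least three grains; once every vertex has
toppled, each has lost three grains and received three. -/
theorem exists_legalPath_of_burnt {x : Fin (n + 3) → Bool} (hx : IsAcyclicOrientation x) (N : ℕ) :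
    ∀ (T : Finset (Fin (n + 3))) (d : Fin (n + 3) → ℕ), Tᶜ.card = N →
      (∀ v, d v + (if v ∈ T then 3 else 0) = cycleInDegree x v + 1 +
        (if v - 1 ∈ T then 1 else 0) + (if v + 1 ∈ T then 1 else 0)) →
      ∃ k, LegalPath (wheelGraph (n + 3)) (FullToppling (wheelGraph (n + 3))) k d
        (cycleInDegree x) := by
  induction N with
  | zero =>
    intro T d hT hd
    rw [Finset.card_eq_zero, Finset.compl_eq_empty_iff] at hT
    subst hT
    have : d = cycleInDegree x := by
      funext v
      have := hd v
      simp only [Finset.mem_univ, if_true] at this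
      omega
    exact ⟨0, this ▸ .nil _⟩
  | succ N ih =>
    intro T d hT hd
    obtain ⟨i, hi, hb⟩ := exists_burnable hx (T := T) (by rintro rfl; simp at hT)
    have h3 : 3 ≤ d i := by
      have := hd i
      rw [if_neg hi] at this
      omega
    obtain ⟨k, hk⟩ := ih (insert i T)
      (sendGrains d i ((wheelGraph (n + 3)).neighborFinset (some i)))
      (by rw [Finset.compl_insert, Finset.card_erase_of_mem (by simpa using hi), hT]; rfl)
      (fun v => by
        have hv := hd v
        have hcard : ((wheelGraph (n + 3)).neighborFinset (some i)).card = 3 := by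
          rw [SimpleGraph.card_neighborFinset_eq_degree, degree_wheelGraph]
        simp only [sendGrains, hcard]
        rw [neighborFinset_wheelGraph]
        have e1 := add_one_ne i
        have e2 := sub_one_ne i
        have e3 := sub_one_ne_add_one i
        have hs : v - 1 = i ↔ v = i + 1 := sub_eq_iff_eq_add
        have ha : v + 1 = i ↔ v = i - 1 := eq_sub_iff_add_eq.symm
        simp only [Finset.mem_insert, Finset.mem_singleton, reduceCtorEq, Option.some.injEq,
          false_or, hs, ha]
        by_cases h1 : v = i
        · subst h1
          simp only [if_true, true_or, e1.symm, e2.symm, false_or, if_false, if_neg hi] at hv ⊢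
          omega
        · by_cases h2 : v = i + 1
          · subst h2
            simp only [add_sub_cancel_right, if_neg hi, e1, e3.symm, if_false, if_true, true_or,
              or_true, false_or] at hv ⊢
            omega
          · by_cases h4 : v = i - 1
            · subst h4
              simp only [sub_add_cancel, if_neg hi, e2, e3, if_false, if_true, true_or,
                false_or] at hv ⊢
              omega
            · simp only [h1, h2, h4, if_false, false_or]
              omega)
    exact ⟨k + 1, .cons rfl (by rwa [degree_wheelGraph]) hk⟩

theorem exists_full_legalPath {x : Fin (n + 3) → Bool} (hx : IsAcyclicOrientation x) :
    ∃ e k, LegalPath (wheelGraph (n + 3)) (FullToppling (wheelGraph (n + 3))) k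
      (maxStable (wheelGraph (n + 3)) + e) (cycleInDegree x) := by
  obtain ⟨k, hk⟩ := exists_legalPath_of_burnt hx _ ∅ (cycleInDegree x + 1) rfl (by simp)
  refine ⟨cycleInDegree x, ?_⟩
  -- Two grains everywhere are two topplings of the sink, so the burning sequence is run twice, the
  -- first time with one grain per vertex set aside.
  have : maxStable (wheelGraph (n + 3)) + cycleInDegree x = cycleInDegree x + 1 + 1 := by
    funext i
    simp only [maxStable_wheelGraph, Pi.add_apply, Pi.one_apply]
    omega
  rw [this]
  exact (hk.add (fun _ _ h => h.subset) 1).trans hk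

theorem cycleInDegree_of_not_isAcyclicOrientation {x : Fin (n + 3) → Bool}
    (hx : ¬ IsAcyclicOrientation x) : cycleInDegree x = 1 := by
  simp only [IsAcyclicOrientation, not_exists, not_not] at hx
  funext i
  rw [cycleInDegree, hx (i - 1) i]
  cases x i <;> rfl

theorem exists_partial_legalPath (x : Fin (n + 3) → Bool) :
    ∃ e k, LegalPath (wheelGraph (n + 3)) (PartialToppling (wheelGraph (n + 3))) k
      (maxStable (wheelGraph (n + 3)) + e) (cycleInDegree x) := by
  have hmono : ∀ i A, FullToppling (wheelGraph (n + 3)) i A →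
      PartialToppling (wheelGraph (n + 3)) i A := fun _ _ h => h.subset
  by_cases hx : IsAcyclicOrientation x
  · obtain ⟨e, k, h⟩ := exists_full_legalPath hx
    exact ⟨e, k, h.mono hmono⟩
  · rw [cycleInDegree_of_not_isAcyclicOrientation hx]
    -- A directed cycle with the edge between `0` and `1` reversed: in-degree two at `0`, zero at
    -- `1`, one elsewhere. With a third grain at `0`, sending one to the sink and one to `1` leaves
    -- one grain everywhere.
    set y : Fin (n + 3) → Bool := fun i => !decide (i = 0) with hy
    obtain ⟨e, k, h⟩ := exists_full_legalPath (x := y) ⟨0, 1, by simp [hy]⟩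
    have e1 := add_one_ne (0 : Fin (n + 3))
    rw [zero_add] at e1
    have h1 := (h.mono hmono).add (fun _ _ h => h) (Pi.single 0 1)
    have h2 : LegalPath (wheelGraph (n + 3)) (PartialToppling (wheelGraph (n + 3))) 1
        (cycleInDegree y + Pi.single 0 1) _ :=
      .single (i := 0) (A := {none, some 1})
        (by
          rw [PartialToppling, neighborFinset_wheelGraph, zero_add]
          intro w
          simp only [Finset.mem_insert, Finset.mem_singleton]
          tauto)
        (by
          rw [degree_wheelGraph]
          simp [cycleInDegree, hy])
    have h3 : sendGrains (cycleInDegree y + Pi.single 0 1) 0 {none, some 1} = 1 := by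
      funext v
      have hs : v - 1 = 0 ↔ v = 1 := sub_eq_zero
      simp only [sendGrains, Pi.add_apply, cycleInDegree, hy, hs, Pi.one_apply]
      by_cases hv : v = 0
      · subst hv
        simp [e1.symm]
      · by_cases hv1 : v = 1
        · subst hv1
          simp [e1]
        · simp [hv, hv1]
    rw [h3] at h2
    rw [add_assoc] at h1
    exact ⟨_, h1.trans h2⟩

/-! ### Minimal recurrent configurations are the in-degree vectors -/

theorem exists_isAcyclicOrientation :
    ∃ x, IsAcyclicOrientation x ∧
      ∀ e, cycleInDegree x ≤ maxStable (wheelGraph (n + 3)) + e := by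
  refine ⟨fun i => decide (i = 0), ⟨0, 1, by simp⟩, fun e i => ?_⟩
  rw [maxStable_wheelGraph]
  exact (cycleInDegree_le_two _ i).trans (Nat.le_add_right _ _)

theorem minimal_iff_exists_cycleInDegree {P : (Fin (n + 3) → ℕ) → Prop}
    {Q : (Fin (n + 3) → Bool) → Prop} (hPQ : ∀ c, P c → ∃ x, Q x ∧ cycleInDegree x ≤ c)
    (hQP : ∀ x, Q x → P (cycleInDegree x)) (c : Fin (n + 3) → ℕ) :
    Minimal P c ↔ ∃ x, Q x ∧ c = cycleInDegree x := by
  constructor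
  · intro h
    obtain ⟨x, hx, hxc⟩ := hPQ c h.prop
    exact ⟨x, hx, (h.eq_of_le (hQP x hx) hxc).symm⟩
  · rintro ⟨x, hx, rfl⟩
    refine ⟨hQP x hx, fun d hd hdx => ?_⟩
    obtain ⟨y, -, hy⟩ := hPQ d hd
    have h1 : cycleInDegree y ≤ cycleInDegree x := hy.trans hdx
    -- Comparable in-degree vectors coincide because their sums are equal.
    have h2 : ∀ i, cycleInDegree y i = cycleInDegree x i := by
      have := (Finset.sum_eq_sum_iff_of_le fun i (_ : i ∈ Finset.univ) => h1 i).1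
        ((sum_cycleInDegree y).trans (sum_cycleInDegree x).symm)
      exact fun i => this i (Finset.mem_univ i)
    exact fun i => (h2 i).symm.trans_le (hy i)

theorem minimal_isSSMRecurrent_iff (p : Set.Ioo (0 : ℝ) 1) (r : TopplingRule (wheelGraph (n + 3)))
    {μ : PMF (Fin (n + 3))} (hμ : ∀ i, μ i ≠ 0) (c : Fin (n + 3) → ℕ) :
    Minimal (IsSSMRecurrent (wheelGraph_adj_sink (n + 3)) p r μ) c ↔
      ∃ x, c = cycleInDegree x := by
  refine (minimal_iff_exists_cycleInDegree (Q := fun _ => True) ?_ ?_ c).trans (by simp)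
  · intro c hc
    obtain ⟨-, e, k, h⟩ := (isSSMRecurrent_iff _ p r hμ c).1 hc
    obtain ⟨x, -, hx⟩ := exists_isAcyclicOrientation (n := n)
    obtain ⟨y, hy⟩ := exists_cycleInDegree_le_of_partial h ⟨x, hx e⟩
    exact ⟨y, trivial, hy⟩
  · intro x _
    exact (isSSMRecurrent_iff _ p r hμ _).2 ⟨isStable_cycleInDegree x, exists_partial_legalPath x⟩

theorem minimal_isASMRecurrent_iff (r : TopplingRule (wheelGraph (n + 3)))
    {μ : PMF (Fin (n + 3))} (hμ : ∀ i, μ i ≠ 0) (c : Fin (n + 3) → ℕ) :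
    Minimal (IsASMRecurrent (wheelGraph_adj_sink (n + 3)) μ) c ↔
      ∃ x, IsAcyclicOrientation x ∧ c = cycleInDegree x := by
  refine minimal_iff_exists_cycleInDegree ?_ ?_ c
  · intro c hc
    obtain ⟨-, e, k, h⟩ := (isASMRecurrent_iff _ r hμ c).1 hc
    obtain ⟨x, hx, hxe⟩ := exists_isAcyclicOrientation (n := n)
    exact exists_cycleInDegree_le_of_full h ⟨x, hx, hxe e⟩
  · intro x hx
    exact (isASMRecurrent_iff _ r hμ _).2 ⟨isStable_cycleInDegree x, exists_full_legalPath hx⟩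

theorem isAcyclicOrientation_iff_exists_eq_two (x : Fin (n + 3) → Bool) :
    IsAcyclicOrientation x ↔ ∃ i, cycleInDegree x i = 2 := by
  constructor
  · intro hx
    -- The first vertex to burn has no burnt neighbour on the cycle, so its in-degree is two.
    obtain ⟨i, -, hi⟩ := exists_burnable hx (T := ∅) Finset.univ_nonempty.ne_empty.symm
    exact ⟨i, le_antisymm (cycleInDegree_le_two x i) (by simpa using hi)⟩
  · rintro ⟨i, hi⟩
    by_contra h
    rw [cycleInDegree_of_not_isAcyclicOrientation h] at hi
    simp at hi

end Wheel

end Sandpile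

namespace Sandpile

/-! ### In-degree vectors and the strict `02`-cycle condition -/

section ZeroTwo

open scoped Fin.CommRing

variable {n : ℕ}

theorem mem_clockwiseIoo_iff {N : ℕ} (i j l : Fin N) :
    l ∈ clockwiseIoo i j ↔ 0 < (l - i).val ∧ ((l - i).val < (j - i).val ∨ i = j) := by
  have key : ∀ a b : Fin N, (b - a).val = if a ≤ b then b.val - a.val else N + b.val - a.val := by
    intro a b
    split_ifs with h
    · exact Fin.coe_sub_iff_le.2 h
    · exact Fin.coe_sub_iff_lt.2 (not_le.1 h)
  rw [key, key, clockwiseIoo]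
  have hi := i.isLt
  have hj := j.isLt
  have hl := l.isLt
  simp only [Fin.le_def, Fin.lt_def, Fin.ext_iff]
  split_ifs with h1 h2 h3
  all_goals first
    | change (i.val < l.val ∧ l.val < j.val) ↔ _; omega
    | change (i.val < l.val ∨ l.val < j.val) ↔ _; omega

/-- Taking `L = n + 3` rather than `0` for `i = j` treats the full turn like any other arc. -/
theorem exists_arc (i j : Fin (n + 3)) :
    ∃ L : ℕ, 0 < L ∧ L ≤ n + 3 ∧ j = i + (L : Fin (n + 3)) ∧
      ∀ l, l ∈ clockwiseIoo i j ↔ ∃ t : ℕ, 0 < t ∧ t < L ∧ l = i + (t : Fin (n + 3)) := by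
  by_cases hij : i = j
  · subst hij
    refine ⟨n + 3, by omega, le_rfl, by simp, fun l => ?_⟩
    rw [mem_clockwiseIoo_iff]
    constructor
    · rintro ⟨h, -⟩
      exact ⟨(l - i).val, h, (l - i).isLt, by rw [Fin.cast_val_eq_self]; abel⟩
    · rintro ⟨t, ht, htL, rfl⟩
      rw [add_sub_cancel_left, Fin.val_cast_of_lt htL]
      exact ⟨ht, .inr rfl⟩
  · refine ⟨(j - i).val, ?_, (j - i).isLt.le, by rw [Fin.cast_val_eq_self]; abel, fun l => ?_⟩
    · rw [Nat.pos_iff_ne_zero, Ne, ← Fin.val_zero (n + 3), Fin.val_inj, sub_eq_zero]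
      exact Ne.symm hij
    · rw [mem_clockwiseIoo_iff]
      simp only [hij, or_false]
      constructor
      · rintro ⟨h, h'⟩
        exact ⟨(l - i).val, h, h', by rw [Fin.cast_val_eq_self]; abel⟩
      · rintro ⟨t, ht, htL, rfl⟩
        rw [add_sub_cancel_left, Fin.val_cast_of_lt (htL.trans (j - i).isLt)]
        exact ⟨ht, htL⟩

theorem mem_clockwiseIoo_sub {L : ℕ} (hL : 0 < L) (hL' : L ≤ n + 3) (j l : Fin (n + 3))
    (hl : l ∈ clockwiseIoo (j - (L : Fin (n + 3))) j) :
    ∃ t : ℕ, 0 < t ∧ t < L ∧ l = j - (t : Fin (n + 3)) := by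
  have hsub : ∀ s, s ≤ L → j - (L : Fin (n + 3)) + (s : Fin (n + 3)) =
      j - ((L - s : ℕ) : Fin (n + 3)) := by
    intro s hs
    rw [Nat.cast_sub hs]
    abel
  obtain ⟨M, hM, hM', hjM, h⟩ := exists_arc (j - (L : Fin (n + 3))) j
  obtain ⟨t, ht, htM, rfl⟩ := (h l).1 hl
  -- Both lengths lie between `1` and `n + 3` and are congruent modulo `n + 3`.
  have hML : M = L := by
    have h1 : (M : Fin (n + 3)) = (L : Fin (n + 3)) := by
      calc (M : Fin (n + 3)) = j - (L : Fin (n + 3)) + (M : Fin (n + 3)) - j + L := by abel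
        _ = L := by rw [← hjM]; abel
    rcases hM'.lt_or_eq with hlt | rfl
    · rcases hL'.lt_or_eq with hlt' | rfl
      · rw [← Fin.val_cast_of_lt hlt, h1, Fin.val_cast_of_lt hlt']
      · have := congrArg Fin.val h1
        rw [Fin.val_cast_of_lt hlt, Fin.natCast_self] at this
        simp at this
        omega
    · rcases hL'.lt_or_eq with hlt' | rfl
      · have := congrArg Fin.val h1
        rw [Fin.val_cast_of_lt hlt', Fin.natCast_self] at this
        simp at this
        omega
      · rfl
  subst hML
  exact ⟨M - t, by omega, by omega, hsub t htM.le⟩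

/-- Along an arc between zeros the edges start clockwise and end anticlockwise. A switch back would
be a zero inside the arc, so there is a single switch, and it is the unique two. -/
theorem uniqueBetween_cycleInDegree_zero_two (x : Fin (n + 3) → Bool) :
    UniqueBetween (cycleInDegree x) 0 2 := by
  intro i j hi hj hne
  obtain ⟨L, hL, -, rfl, hmem⟩ := exists_arc i j
  set y : ℕ → Bool := fun t => x (i + (t : Fin (n + 3))) with hy
  have hf : ∀ t : ℕ, cycleInDegree x (i + ((t + 1 : ℕ) : Fin (n + 3))) =
      (y t).toNat + (!y (t + 1)).toNat := by
    intro t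
    simp only [cycleInDegree, hy]
    rw [Nat.cast_succ, ← add_assoc, add_sub_cancel_right]
  have hy0 : y 0 = true := by
    simp only [hy, Nat.cast_zero, add_zero]
    simp only [cycleInDegree] at hi
    cases h : x i <;> simp_all
  have hyL : y (L - 1) = false := by
    have := hf (L - 1)
    rw [Nat.sub_add_cancel hL, hj] at this
    cases h : y (L - 1)
    · rfl
    · rw [h, Bool.toNat_true] at this
      omega
  have hstep : ∀ t, t + 1 < L → y t = false → y (t + 1) = false := by
    intro t ht h
    have h1 := hne _ ((hmem _).2 ⟨t + 1, by omega, ht, rfl⟩)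
    rw [hf, h] at h1
    cases h2 : y (t + 1) <;> simp_all
  have hex : ∃ t, y t = false := ⟨_, hyL⟩
  classical
  obtain ⟨t, ht⟩ : ∃ t, Nat.find hex = t + 1 :=
    Nat.exists_eq_succ_of_ne_zero fun h => by
      have := Nat.find_spec hex
      rw [h, hy0] at this
      cases this
  have htrue : ∀ s ≤ t, y s = true := fun s hs => by
    simpa using Nat.find_min hex (m := s) (by omega)
  have htL : t + 1 ≤ L - 1 := ht ▸ Nat.find_min' hex hyL
  have hfalse : ∀ s, t + 1 ≤ s → s < L → y s = false := by
    intro s hs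
    induction s, hs using Nat.le_induction with
    | base => exact fun _ => ht ▸ Nat.find_spec hex
    | succ s _ ih => exact fun h => hstep s h (ih (by omega))
  refine ⟨i + ((t + 1 : ℕ) : Fin (n + 3)), ⟨(hmem _).2 ⟨t + 1, by omega, by omega, rfl⟩, ?_⟩, ?_⟩
  · rw [hf, htrue t le_rfl, hfalse (t + 1) le_rfl (by omega)]
    rfl
  · rintro k ⟨hk, hk2⟩
    obtain ⟨s, hs, hsL, rfl⟩ := (hmem k).1 hk
    obtain ⟨s, rfl⟩ := Nat.exists_eq_succ_of_ne_zero hs.ne'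
    rw [Nat.succ_eq_add_one, hf] at hk2
    have h1 : y s = true := by cases h : y s <;> cases h' : y (s + 1) <;> simp_all
    have h2 : y (s + 1) = false := by cases h : y s <;> cases h' : y (s + 1) <;> simp_all
    have h3 : s = t := by
      by_contra hst
      rcases Nat.lt_or_gt_of_ne hst with h | h
      · rw [htrue (s + 1) (by omega)] at h2; cases h2
      · rw [hfalse s (by omega) (by omega)] at h1; cases h1
    rw [h3]

theorem strictZeroTwoCycle_cycleInDegree (x : Fin (n + 3) → Bool) :
    StrictZeroTwoCycle (cycleInDegree x) := by
  refine ⟨uniqueBetween_cycleInDegree_zero_two x, ?_⟩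
  -- Reversing all edges exchanges zeros and twos.
  have h := uniqueBetween_cycleInDegree_zero_two fun j => !x j
  have h0 : ∀ i, cycleInDegree (fun j => !x j) i = 0 ↔ cycleInDegree x i = 2 := fun i => by
    have := cycleInDegree_not x i
    omega
  have h2 : ∀ i, cycleInDegree (fun j => !x j) i = 2 ↔ cycleInDegree x i = 0 := fun i => by
    have := cycleInDegree_not x i
    omega
  simpa only [UniqueBetween, ne_eq, h0, h2] using h

theorem sub_natCast_add_one (i : Fin (n + 3)) (s : ℕ) :
    i - ((s + 1 : ℕ) : Fin (n + 3)) = i - 1 - (s : Fin (n + 3)) := by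
  rw [Nat.cast_succ]
  abel

/-- Two consecutive vertices with value `a` cannot be separated only by vertices with value one. -/
theorem UniqueBetween.false_of_ones {c : Fin (n + 3) → ℕ} {a b : ℕ} (h : UniqueBetween c a b)
    (ha : a ≠ 1) (hb : b ≠ 1) {i : Fin (n + 3)} {t : ℕ} (hi : c i = a)
    (ht : c (i - 1 - (t : Fin (n + 3))) = a)
    (hones : ∀ s < t, c (i - 1 - (s : Fin (n + 3))) = 1) : False := by
  have htn : t + 1 ≤ n + 3 := by
    -- The vertex `n + 3` steps back from `i` is `i` itself, whose value `a` is not one.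
    by_contra hcon
    have := hones (n + 2) (by omega)
    rw [← sub_natCast_add_one, Fin.natCast_self, sub_zero, hi] at this
    exact ha this
  have hval : ∀ l ∈ clockwiseIoo (i - ((t + 1 : ℕ) : Fin (n + 3))) i, c l = 1 := by
    intro l hl
    obtain ⟨s, hs, hst, rfl⟩ := mem_clockwiseIoo_sub (by omega) htn i l hl
    obtain ⟨s, rfl⟩ := Nat.exists_eq_succ_of_ne_zero hs.ne'
    rw [Nat.succ_eq_add_one, sub_natCast_add_one]
    exact hones s (by omega)
  obtain ⟨k, ⟨hk, hkb⟩, -⟩ := h (i - ((t + 1 : ℕ) : Fin (n + 3))) i (by rw [sub_natCast_add_one, ht]) hi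
    fun l hl => by rw [hval l hl]; exact ha.symm
  exact hb (hkb.symm.trans (hval k hk))

theorem StrictZeroTwoCycle.exists_eq_cycleInDegree {c : Fin (n + 3) → ℕ} (hc : ∀ i, c i ≤ 2)
    (h : StrictZeroTwoCycle c) : ∃ x, c = cycleInDegree x := by
  classical
  -- The edge from `i` to `i + 1` points clockwise when the first value other than one, read
  -- anticlockwise starting at `i` itself, is zero. If all values are one, every edge points
  -- anticlockwise.
  set X : Fin (n + 3) → Prop := fun i => ∃ t : ℕ, c (i - (t : Fin (n + 3))) = 0 ∧
    ∀ s < t, c (i - (s : Fin (n + 3))) = 1 with hX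
  refine ⟨fun i => decide (X i), ?_⟩
  funext i
  have hci := hc i
  simp only [cycleInDegree]
  obtain h0 | h1 | h2 : c i = 0 ∨ c i = 1 ∨ c i = 2 := by omega
  · have hx : X i := ⟨0, by simpa using h0, by simp⟩
    have hx' : ¬ X (i - 1) := by
      rintro ⟨t, ht, hones⟩
      exact h.1.false_of_ones (by simp) (by simp) h0 ht hones
    simp [hx, hx', h0]
  · have hx : X i ↔ X (i - 1) := by
      constructor
      · rintro ⟨t, ht, hones⟩
        cases t with
        | zero => simp [h1] at ht
        | succ t =>
          refine ⟨t, by rwa [sub_natCast_add_one] at ht, fun s hs => ?_⟩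
          have := hones (s + 1) (by omega)
          rwa [sub_natCast_add_one] at this
      · rintro ⟨t, ht, hones⟩
        refine ⟨t + 1, by rwa [sub_natCast_add_one], fun s hs => ?_⟩
        cases s with
        | zero => simpa using h1
        | succ s => rw [sub_natCast_add_one]; exact hones s (by omega)
    by_cases hxi : X (i - 1) <;> simp [hx, hxi, h1]
  · have hx : ¬ X i := by
      rintro ⟨t, ht, hones⟩
      cases t with
      | zero => simp [h2] at ht
      | succ t =>
        have := hones 0 (by omega)
        simp [h2] at this
    have hx' : X (i - 1) := by
      -- The search back from `i - 1` stops at the latest at `i`, where the value is two; by the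
      -- `02`-condition it cannot stop at a two.
      have hex : ∃ t : ℕ, c (i - 1 - (t : Fin (n + 3))) ≠ 1 := by
        refine ⟨n + 2, ?_⟩
        rw [← sub_natCast_add_one, Fin.natCast_self, sub_zero, h2]
        simp
      have hones : ∀ s < Nat.find hex, c (i - 1 - (s : Fin (n + 3))) = 1 := fun s hs =>
        not_not.1 (Nat.find_min hex hs)
      have hle := hc (i - 1 - (Nat.find hex : Fin (n + 3)))
      have hne := Nat.find_spec hex
      by_cases hz : c (i - 1 - (Nat.find hex : Fin (n + 3))) = 0
      · exact ⟨_, hz, hones⟩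
      · exact (h.2.false_of_ones (by simp) (by simp) h2 (by omega) hones).elim
    simp [hx, hx', h2]

theorem strictZeroTwoCycle_iff {c : Fin (n + 3) → ℕ} (hc : ∀ i, c i ≤ 2) :
    StrictZeroTwoCycle c ↔ ∃ x, c = cycleInDegree x :=
  ⟨fun h => h.exists_eq_cycleInDegree hc, by
    rintro ⟨x, rfl⟩
    exact strictZeroTwoCycle_cycleInDegree x⟩

end ZeroTwo

end Sandpile

open Sandpile in
theorem theorem3p3 (n : ℕ) (hn : 3 ≤ n) (p : Set.Ioo (0 : ℝ) 1)
    (r : TopplingRule (wheelGraph n)) (μ : PMF (Fin n)) (hμ : ∀ i, μ i ≠ 0)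
    (c : Fin n → ℕ) (hc : ∀ i, c i ≤ 2) :
    (Minimal (IsSSMRecurrent (wheelGraph_adj_sink n) p r μ) c ↔ StrictZeroTwoCycle c) ∧
    (Minimal (IsASMRecurrent (wheelGraph_adj_sink n) μ) c ↔
      Minimal (IsSSMRecurrent (wheelGraph_adj_sink n) p r μ) c ∧ ∃ i, c i = 2) := by
  obtain ⟨n, rfl⟩ := Nat.exists_eq_add_of_le' hn
  rw [minimal_isSSMRecurrent_iff p r hμ, minimal_isASMRecurrent_iff r hμ,
    strictZeroTwoCycle_iff hc]
  refine ⟨Iff.rfl, ?_⟩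
  constructor
  · rintro ⟨x, hx, rfl⟩
    exact ⟨⟨x, rfl⟩, (isAcyclicOrientation_iff_exists_eq_two x).1 hx⟩
  · rintro ⟨⟨x, rfl⟩, h⟩
    exact ⟨x, (isAcyclicOrientation_iff_exists_eq_two x).2 h, rfl⟩
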